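/- Let $X$ be a complex Banach space and let $T$ be a bounded linear operator on $X$. A bounded operator $S$ on a Banach space is \emph{upper semi-Fredholm} if its range is closed and $\dim \ker S<\infty$, \emph{lower semi-Fredholm} if its range has finite codimension, and \emph{semi-Fredholm} if it is upper or lower semi-Fredholm; then $\operatorname{ind}(S)=\dim\ker S-\operatorname{codim}\operatorname{ran} S\in\mathbb Z\cup\{-\infty,+\infty\}$. It is \emph{quasi-nilpotent} if its spectrum is contained in $\{0\}$ (the operator on the zero space, whose spectrum is empty, is quasi-nilpotent). The operator $T$ is \emph{pseudo semi-B-Fredholm} if there are closed $T$-invariant subspaces $M,N$ of $X$ with $X=M\oplus N$ such that the restriction $T_M\colon M\to M$ is semi-Fredholm and the restriction $T_N\colon N\to N$ is quasi-nilpotent; its index is then $\operatorname{ind}(T):=\operatorname{ind}(T_M)$ for any such pair $(M,N)$. Suppose that $T$ is pseudo semi-B-Fredholm. Then $\operatorname{ind}(T)$ is well defined, that is, $\operatorname{ind}(T_M)$ is the same for all pairs $(M,N)$ as above, and for every integer $n\ge 1$ the operator $T^n$ is pseudo semi-B-Fredholm and $$\operatorname{ind}(T^n)=n\cdot\operatorname{ind}(T)\quad\text{in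 }\mathbb Z\cup\{-\infty,+\infty\}.$$ -/

import Mathlib

noncomputable section

namespace PseudoFredholm

variable {X : Type*} [NormedAddCommGroup X] [NormedSpace ℂ X]

/-- The dimension of the kernel of `T`, an element of `{0, 1, 2, …, ∞}`. -/
def nullity (T : X →L[ℂ] X) : ℕ∞ :=
  Cardinal.toENat (Module.rank ℂ (LinearMap.ker (T : X →ₗ[ℂ] X)))

/-- The codimension of the range of `T`, an element of `{0, 1, 2, …, ∞}`. -/
def deficiency (T : X →L[ℂ] X) : ℕ∞ :=
  Cardinal.toENat (Module.rank ℂ (X ⧸ LinearMap.range (T : X →ₗ[ℂ] X)))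

/-- Upper semi-Fredholm: closed range and finite-dimensional kernel. -/
def IsUpperSemiFredholm (T : X →L[ℂ] X) : Prop :=
  IsClosed (Set.range T) ∧ nullity T < ⊤

/-- Lower semi-Fredholm: range of finite codimension. -/
def IsLowerSemiFredholm (T : X →L[ℂ] X) : Prop :=
  deficiency T < ⊤

/-- Semi-Fredholm: upper or lower semi-Fredholm. -/
def IsSemiFredholm (T : X →L[ℂ] X) : Prop :=
  IsUpperSemiFredholm T ∨ IsLowerSemiFredholm T

/-- The index `dim ker T - codim ran T` of a semi-Fredholm operator, a value in `ℤ ∪ {-∞, +∞}`.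
At most one of the two terms is infinite when `T` is semi-Fredholm. -/
def semiFredholmIndex (T : X →L[ℂ] X) : EReal :=
  (((nullity T : ℕ∞) : ENNReal) : EReal) - (((deficiency T : ℕ∞) : ENNReal) : EReal)

/-- Quasi-nilpotent: no spectrum outside `0`. The spectrum is `{0}` on a nonzero Banach space and
empty on the zero space, whose only operator counts as quasi-nilpotent. -/
def IsQuasinilpotent (T : X →L[ℂ] X) : Prop :=
  spectrum ℂ T ⊆ {0}

/-- `Red T`: pairs `(M, N)` of closed `T`-invariant subspaces with `X = M ⊕ N`. -/
structure Red (T : X →L[ℂ] X) where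
  M : Submodule ℂ X
  N : Submodule ℂ X
  isClosed_M : IsClosed (M : Set X)
  isClosed_N : IsClosed (N : Set X)
  invariant_M : ∀ x ∈ M, T x ∈ M
  invariant_N : ∀ x ∈ N, T x ∈ N
  isCompl : IsCompl M N

/-- The restriction `T_M : M → M`. -/
def Red.restrictM {T : X →L[ℂ] X} (P : Red T) : P.M →L[ℂ] P.M :=
  T.restrict P.invariant_M

/-- The restriction `T_N : N → N`. -/
def Red.restrictN {T : X →L[ℂ] X} (P : Red T) : P.N →L[ℂ] P.N :=
  T.restrict P.invariant_N

/-- Upper pseudo semi-B-Fredholm operators. -/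
def IsUpperPseudoSemiBFredholm (T : X →L[ℂ] X) : Prop :=
  ∃ P : Red T, IsUpperSemiFredholm P.restrictM ∧ IsQuasinilpotent P.restrictN

/-- Lower pseudo semi-B-Fredholm operators. -/
def IsLowerPseudoSemiBFredholm (T : X →L[ℂ] X) : Prop :=
  ∃ P : Red T, IsLowerSemiFredholm P.restrictM ∧ IsQuasinilpotent P.restrictN

/-- Pseudo semi-B-Fredholm operators. -/
def IsPseudoSemiBFredholm (T : X →L[ℂ] X) : Prop :=
  IsUpperPseudoSemiBFredholm T ∨ IsLowerPseudoSemiBFredholm T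

theorem isPseudoSemiBFredholm_iff (T : X →L[ℂ] X) :
    IsPseudoSemiBFredholm T ↔
      ∃ P : Red T, IsSemiFredholm P.restrictM ∧ IsQuasinilpotent P.restrictN := by
  constructor
  · rintro (⟨P, h, q⟩ | ⟨P, h, q⟩)
    · exact ⟨P, Or.inl h, q⟩
    · exact ⟨P, Or.inr h, q⟩
  · rintro ⟨P, h | h, q⟩
    · exact Or.inl ⟨P, h, q⟩
    · exact Or.inr ⟨P, h, q⟩

open Classical in
/-- The index of a pseudo semi-B-Fredholm operator `T`: the index of the semi-Fredholm operator
`T_M`, for some `(M, N) ∈ Red T` with `T_M` semi-Fredholm and `T_N` quasi-nilpotent (and the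
default value `0` if `T` is not pseudo semi-B-Fredholm). -/
def pseudoIndex (T : X →L[ℂ] X) : EReal :=
  if h : IsPseudoSemiBFredholm T then
    semiFredholmIndex ((isPseudoSemiBFredholm_iff T).1 h).choose.restrictM
  else 0

end PseudoFredholm

end

/-! Perturb `T` by a small nonzero scalar `c`. On `N` the operator `T_N + c` is bijective because
`T_N` is quasi-nilpotent, so `T + c` has the index of `T_M + c`; on `M` the index of a semi-Fredholm
operator is stable, so this is the index of `T_M`. Hence `ind T_M` is the index of `T + c` for all
small `c ≠ 0`, a quantity that does not mention the decomposition
(`Red.eventually_semiFredholmIndex_eq`).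

For powers the same pair `(M, N)` serves: `T_N ^ n` is quasi-nilpotent by spectral mapping, `T_M ^
n` is semi-Fredholm, and its index follows from the six-term kernel-cokernel sequence
(`exists_kerDim_cokerDim_comp`). Stability of the index (`eventually_semiFredholmIndex_eq`) is
proved separately for finite index, `-∞` and `+∞`; the infinite cases play Riesz's lemma against
compactness in finite dimension. -/

namespace PseudoFredholm

open Filter Topology

/-! ### Kernel and cokernel dimensions of a composition -/

section Dimension

universe u v w

/-- The dimension of a complex vector space, an element of `{0, 1, 2, …, ∞}`. -/
noncomputable def edim (V : Type*) [AddCommGroup V] [Module ℂ V] : ℕ∞ :=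
  Cardinal.toENat (Module.rank ℂ V)

/-- The dimension of the kernel of a linear map. -/
noncomputable def kerDim {U : Type*} {V : Type*} [AddCommGroup U] [Module ℂ U] [AddCommGroup V]
    [Module ℂ V] (f : U →ₗ[ℂ] V) : ℕ∞ :=
  edim (LinearMap.ker f)

/-- The codimension of the range of a linear map. -/
noncomputable def cokerDim {U : Type*} {V : Type*} [AddCommGroup U] [Module ℂ U] [AddCommGroup V]
    [Module ℂ V] (f : U →ₗ[ℂ] V) : ℕ∞ :=
  edim (V ⧸ LinearMap.range f)

variable {U : Type u} {V : Type v} {W : Type w} [AddCommGroup U] [Module ℂ U]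
  [AddCommGroup V] [Module ℂ V] [AddCommGroup W] [Module ℂ W]

theorem edim_lt_top_iff : edim V < ⊤ ↔ FiniteDimensional ℂ V := by
  rw [edim, lt_top_iff_ne_top, Ne, Cardinal.toENat_eq_top, not_le, Module.rank_lt_aleph0_iff]

theorem edim_congr (e : U ≃ₗ[ℂ] V) : edim U = edim V := by
  have := congrArg Cardinal.toENat e.lift_rank_eq
  simpa [edim] using this

theorem edim_ker_add_edim_range (f : U →ₗ[ℂ] V) :
    edim (LinearMap.ker f) + edim (LinearMap.range f) = edim U := by
  have := congrArg Cardinal.toENat f.lift_rank_range_add_rank_ker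
  rw [map_add] at this
  simpa [edim, add_comm] using this

theorem edim_le_of_injective (f : U →ₗ[ℂ] V) (hf : Function.Injective f) : edim U ≤ edim V := by
  rw [edim_congr (LinearEquiv.ofInjective f hf)]
  exact OrderHomClass.mono Cardinal.toENat (Submodule.rank_le _)

theorem kerDim_eq_zero {f : U →ₗ[ℂ] V} (hf : Function.Injective f) : kerDim f = 0 := by
  simp [kerDim, edim, LinearMap.ker_eq_bot.2 hf]

theorem cokerDim_eq_zero {f : U →ₗ[ℂ] V} (hf : Function.Surjective f) : cokerDim f = 0 := by
  rw [cokerDim, LinearMap.range_eq_top.2 hf]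
  simp [edim]

theorem edim_eq_add_of_exact (f : U →ₗ[ℂ] V) (g : V →ₗ[ℂ] W)
    (h : LinearMap.range f = LinearMap.ker g) :
    edim V = edim (LinearMap.range f) + edim (LinearMap.range g) := by
  rw [h, edim_ker_add_edim_range]

/-- The dimensions in the six-term exact sequence
`0 → ker f → ker (g ∘ f) → ker g → coker f → coker (g ∘ f) → coker g → 0`. -/
theorem exists_kerDim_cokerDim_comp (f : U →ₗ[ℂ] V) (g : V →ₗ[ℂ] W) :
    ∃ a b c : ℕ∞, kerDim (g ∘ₗ f) = kerDim f + a ∧ kerDim g = a + b ∧ cokerDim f = b + c ∧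
      cokerDim (g ∘ₗ f) = c + cokerDim g := by
  let i : LinearMap.ker f →ₗ[ℂ] LinearMap.ker (g ∘ₗ f) :=
    Submodule.inclusion (fun x hx => by simp_all)
  let p : LinearMap.ker (g ∘ₗ f) →ₗ[ℂ] LinearMap.ker g :=
    f.restrict (fun x hx => by simpa using hx)
  let q : LinearMap.ker g →ₗ[ℂ] V ⧸ LinearMap.range f :=
    (LinearMap.range f).mkQ ∘ₗ (LinearMap.ker g).subtype
  let r : (V ⧸ LinearMap.range f) →ₗ[ℂ] W ⧸ LinearMap.range (g ∘ₗ f) :=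
    Submodule.mapQ _ _ g (by rintro _ ⟨x, rfl⟩; exact ⟨x, rfl⟩)
  let s : (W ⧸ LinearMap.range (g ∘ₗ f)) →ₗ[ℂ] W ⧸ LinearMap.range g :=
    Submodule.factor (by rintro _ ⟨x, rfl⟩; exact ⟨f x, rfl⟩)
  have hi : Function.Injective i := Submodule.inclusion_injective _
  have hs : Function.Surjective s := Submodule.factor_surjective _
  have hip : LinearMap.range i = LinearMap.ker p := by
    ext ⟨x, hx⟩
    simp only [LinearMap.mem_range, LinearMap.mem_ker, Subtype.ext_iff, i, p]
    constructor
    · rintro ⟨y, rfl⟩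
      exact y.2
    · intro h
      exact ⟨⟨x, h⟩, rfl⟩
  have hpq : LinearMap.range p = LinearMap.ker q := by
    ext ⟨x, hx⟩
    simp only [LinearMap.mem_range, LinearMap.mem_ker, Subtype.ext_iff, p, q, LinearMap.comp_apply,
      Submodule.mkQ_apply, Submodule.Quotient.mk_eq_zero, Submodule.subtype_apply]
    constructor
    · rintro ⟨y, hy⟩
      exact ⟨y, hy⟩
    · rintro ⟨y, rfl⟩
      exact ⟨⟨y, hx⟩, rfl⟩
  have hqr : LinearMap.range q = LinearMap.ker r := by
    ext x
    obtain ⟨x, rfl⟩ := Submodule.Quotient.mk_surjective _ x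
    simp only [LinearMap.mem_range, LinearMap.mem_ker, q, r, LinearMap.comp_apply,
      Submodule.mkQ_apply, Submodule.mapQ_apply, Submodule.Quotient.mk_eq_zero,
      Submodule.subtype_apply, Submodule.Quotient.eq]
    constructor
    · rintro ⟨⟨y, hy⟩, z, hz⟩
      have := congrArg g hz
      rw [map_sub, LinearMap.mem_ker.1 hy] at this
      exact ⟨-z, by simp [this]⟩
    · rintro ⟨y, hy⟩
      exact ⟨⟨x - f y, by simp_all⟩, -y, by simp⟩
  have hrs : LinearMap.range r = LinearMap.ker s := by
    ext x
    obtain ⟨x, rfl⟩ := Submodule.Quotient.mk_surjective _ x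
    have : s (Submodule.Quotient.mk x) = Submodule.Quotient.mk x := rfl
    rw [LinearMap.mem_ker, this, Submodule.Quotient.mk_eq_zero]
    constructor
    · rintro ⟨y, hy⟩
      obtain ⟨y, rfl⟩ := Submodule.Quotient.mk_surjective _ y
      rw [Submodule.mapQ_apply, Submodule.Quotient.eq] at hy
      obtain ⟨z, hz⟩ := hy
      exact ⟨y - f z, by simp_all⟩
    · rintro ⟨y, rfl⟩
      exact ⟨Submodule.Quotient.mk y, rfl⟩
  -- The three numbers are the ranks of the middle maps of the sequence.
  refine ⟨edim (LinearMap.range p), edim (LinearMap.range q), edim (LinearMap.range r), ?_,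
    edim_eq_add_of_exact p q hpq, edim_eq_add_of_exact q r hqr, ?_⟩
  · rw [kerDim, edim_eq_add_of_exact i p hip, kerDim, edim_congr (LinearEquiv.ofInjective i hi)]
  · rw [cokerDim, edim_eq_add_of_exact r s hrs, cokerDim,
      edim_congr (LinearEquiv.ofTop _ (LinearMap.range_eq_top.2 hs))]

/-- Additivity of the index, in a form without subtraction. -/
theorem kerDim_add_kerDim_add_cokerDim_comp (f : U →ₗ[ℂ] V) (g : V →ₗ[ℂ] W) :
    kerDim f + kerDim g + cokerDim (g ∘ₗ f) = kerDim (g ∘ₗ f) + cokerDim f + cokerDim g := by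
  obtain ⟨a, b, c, h₁, h₂, h₃, h₄⟩ := exists_kerDim_cokerDim_comp f g
  rw [h₁, h₂, h₃, h₄]
  ring

theorem kerDim_comp_le (f : U →ₗ[ℂ] V) (g : V →ₗ[ℂ] W) :
    kerDim (g ∘ₗ f) ≤ kerDim f + kerDim g := by
  obtain ⟨a, b, c, h₁, h₂, h₃, h₄⟩ := exists_kerDim_cokerDim_comp f g
  rw [h₁, h₂]
  gcongr
  exact le_self_add

theorem cokerDim_comp_le (f : U →ₗ[ℂ] V) (g : V →ₗ[ℂ] W) :
    cokerDim (g ∘ₗ f) ≤ cokerDim f + cokerDim g := by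
  obtain ⟨a, b, c, h₁, h₂, h₃, h₄⟩ := exists_kerDim_cokerDim_comp f g
  rw [h₃, h₄]
  gcongr
  exact le_add_self

theorem kerDim_le_kerDim_comp (f : U →ₗ[ℂ] V) (g : V →ₗ[ℂ] W) :
    kerDim f ≤ kerDim (g ∘ₗ f) := by
  obtain ⟨a, b, c, h₁, h₂, h₃, h₄⟩ := exists_kerDim_cokerDim_comp f g
  exact h₁ ▸ le_self_add

theorem cokerDim_le_cokerDim_comp (f : U →ₗ[ℂ] V) (g : V →ₗ[ℂ] W) :
    cokerDim g ≤ cokerDim (g ∘ₗ f) := by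
  obtain ⟨a, b, c, h₁, h₂, h₃, h₄⟩ := exists_kerDim_cokerDim_comp f g
  exact h₄ ▸ le_add_self

theorem kerDim_le_kerDim_comp_add (f : U →ₗ[ℂ] V) (g : V →ₗ[ℂ] W) :
    kerDim g ≤ kerDim (g ∘ₗ f) + cokerDim f := by
  obtain ⟨a, b, c, h₁, h₂, h₃, h₄⟩ := exists_kerDim_cokerDim_comp f g
  rw [h₁, h₂, h₃]
  exact add_le_add le_add_self le_self_add

theorem coe_enat_natCast (n : ℕ) : ((((n : ℕ∞) : ENNReal)) : EReal) = ((n : ℝ) : EReal) := by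
  rw [ENat.toENNReal_coe, ← ENNReal.ofReal_natCast, EReal.coe_ennreal_ofReal,
    max_eq_left n.cast_nonneg]

theorem eReal_sub_eq_of_add_eq_add {a b c d : ℕ∞} (hb : b < ⊤) (hc : c < ⊤) (hd : d < ⊤)
    (h : a + d = c + b) :
    ((a : ENNReal) : EReal) - ((b : ENNReal) : EReal) =
      ((c : ENNReal) : EReal) - ((d : ENNReal) : EReal) := by
  have ha : a < ⊤ := (le_self_add.trans_eq h).trans_lt (WithTop.add_lt_top.2 ⟨hc, hb⟩)
  lift a to ℕ using ha.ne
  lift b to ℕ using hb.ne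
  lift c to ℕ using hc.ne
  lift d to ℕ using hd.ne
  have h' : (a : ℝ) + d = c + b := by exact_mod_cast h
  simp only [coe_enat_natCast, ← EReal.coe_sub]
  congr 1
  linarith

end Dimension

/-! ### Perturbation of maps bounded below and of open maps -/

section Perturbation

variable {E G : Type*} [NormedAddCommGroup E] [NormedSpace ℂ E] [NormedAddCommGroup G]
  [NormedSpace ℂ G]

theorem exists_seq_norm_le_two_one_le_norm_sub (h : ¬ FiniteDimensional ℂ E) :
    ∃ f : ℕ → E, (∀ n, ‖f n‖ ≤ 2) ∧ Pairwise fun m n => 1 ≤ ‖f m - f n‖ :=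
  exists_seq_norm_le_one_le_norm_sub' (c := (3 / 2 : ℂ)) (by norm_num) (by norm_num) h

/-- Bounded sequences have convergent subsequences; this contradicts the 1-separated sequence that
Riesz's lemma gives in infinite dimension. -/
theorem exists_ne_norm_sub_lt [FiniteDimensional ℂ E] (x : ℕ → E) {R ε : ℝ}
    (hx : ∀ n, ‖x n‖ ≤ R) (hε : 0 < ε) : ∃ m n, m ≠ n ∧ ‖x m - x n‖ < ε := by
  have := FiniteDimensional.proper ℂ E
  obtain ⟨a, -, φ, hφ, hlim⟩ := tendsto_subseq_of_bounded (Metric.isBounded_closedBall (x := 0))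
    (fun n => mem_closedBall_zero_iff.2 (hx n))
  obtain ⟨N, hN⟩ := Metric.cauchySeq_iff.1 hlim.cauchySeq ε hε
  refine ⟨φ (N + 1), φ N, (hφ (Nat.lt_succ_self N)).ne', ?_⟩
  rw [← dist_eq_norm]
  exact hN (N + 1) (Nat.le_succ N) N le_rfl

theorem isClosed_range_of_norm_le [CompleteSpace E] {A : E →L[ℂ] G} {C : ℝ}
    (hC : ∀ u, ‖u‖ ≤ C * ‖A u‖) : IsClosed (Set.range A) := by
  have : AntilipschitzWith C.toNNReal A := A.antilipschitz_of_bound fun u =>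
    (hC u).trans (mul_le_mul_of_nonneg_right (Real.le_coe_toNNReal C) (norm_nonneg _))
  exact this.isClosed_range A.uniformContinuous

/-- Finite codimension of the range passes from a map bounded below to nearby maps. -/
theorem cokerDim_lt_top_of_norm_sub_le [CompleteSpace E] {A A' : E →L[ℂ] G} {C : ℝ} (hC₀ : 0 ≤ C)
    (hC : ∀ u, ‖u‖ ≤ C * ‖A' u‖) (hA : IsClosed (Set.range A)) (hAA' : C * ‖A - A'‖ ≤ 1 / 16)
    (h : cokerDim (A' : E →ₗ[ℂ] G) < ⊤) : cokerDim (A : E →ₗ[ℂ] G) < ⊤ := by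
  have hA₁ : IsClosed (LinearMap.range (A : E →ₗ[ℂ] G) : Set G) := hA
  have hA₁' : IsClosed (LinearMap.range (A' : E →ₗ[ℂ] G) : Set G) :=
    isClosed_range_of_norm_le hC
  rw [cokerDim, edim_lt_top_iff] at h ⊢
  -- A 1-separated sequence in the cokernel of `A` lifts to a bounded `x n`. Two of its terms are
  -- close modulo the range of `A'`: `x m - x n = z - A' u` with `z` small. Modulo the range of `A`
  -- this is `z + (A - A') u`, of norm below `1/4 + 7/16 < 1`.
  by_contra hfin
  obtain ⟨q, hq, hq'⟩ := exists_seq_norm_le_two_one_le_norm_sub hfin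
  choose x hxq hx using fun n => Submodule.Quotient.norm_mk_lt (q n) one_pos
  have hx3 : ∀ n, ‖x n‖ ≤ 3 := fun n => by linarith [hx n, hq n]
  obtain ⟨m, n, hmn, hlt⟩ := exists_ne_norm_sub_lt
    (fun n => (Submodule.Quotient.mk (x n) : G ⧸ LinearMap.range (A' : E →ₗ[ℂ] G)))
    (R := 3) (ε := 1 / 4) (fun n => (Submodule.Quotient.norm_mk_le _ _).trans (hx3 n)) (by norm_num)
  rw [← Submodule.Quotient.mk_sub] at hlt
  obtain ⟨z, hz, hzlt⟩ := Submodule.Quotient.norm_mk_lt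
    (Submodule.Quotient.mk (x m - x n) : G ⧸ LinearMap.range (A' : E →ₗ[ℂ] G)) (sub_pos.2 hlt)
  obtain ⟨u, hu⟩ := (Submodule.Quotient.eq (LinearMap.range (A' : E →ₗ[ℂ] G))).1 hz
  replace hu : A' u = z - (x m - x n) := hu
  have hz4 : ‖z‖ < 1 / 4 := by linarith
  have hA'u : ‖A' u‖ ≤ 7 := by
    rw [hu]
    linarith [norm_sub_le z (x m - x n), norm_sub_le (x m) (x n), hx3 m, hx3 n]
  have hsmall : ‖(A - A') u‖ ≤ 7 / 16 := by
    calc ‖(A - A') u‖ ≤ ‖A - A'‖ * ‖u‖ := (A - A').le_opNorm u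
      _ ≤ ‖A - A'‖ * (C * 7) := by
        gcongr
        exact (hC u).trans (by gcongr)
      _ = C * ‖A - A'‖ * 7 := by ring
      _ ≤ 7 / 16 := by linarith
  have hone : 1 ≤ ‖q m - q n‖ := hq' hmn
  have hqx : q m - q n = Submodule.Quotient.mk (z + (A - A') u) := by
    rw [← hxq m, ← hxq n, ← Submodule.Quotient.mk_sub, Submodule.Quotient.eq]
    refine ⟨-u, ?_⟩
    simp only [map_neg, ContinuousLinearMap.coe_coe, sub_apply, hu]
    abel
  rw [hqx] at hone
  linarith [Submodule.Quotient.norm_mk_le (LinearMap.range (A : E →ₗ[ℂ] G)) (z + (A - A') u),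
    norm_add_le z ((A - A') u)]

/-- Finite dimension of the kernel passes from an open map to nearby maps. -/
theorem kerDim_lt_top_of_norm_sub_le {A A' : E →L[ℂ] G} {C : ℝ} (hC₀ : 0 ≤ C)
    (hC : ∀ y, ∃ x, A' x = y ∧ ‖x‖ ≤ C * ‖y‖) (hAA' : C * ‖A - A'‖ ≤ 1 / 16)
    (h : kerDim (A' : E →ₗ[ℂ] G) < ⊤) : kerDim (A : E →ₗ[ℂ] G) < ⊤ := by
  rw [kerDim, edim_lt_top_iff] at h ⊢
  by_contra hfin
  obtain ⟨x, hx, hx'⟩ := exists_seq_norm_le_two_one_le_norm_sub hfin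
  -- On `ker A` the map `A'` is small, so a small correction `y n` moves `x n` into the
  -- finite-dimensional `ker A'`.
  choose y hy hyC using fun n => hC (A' (x n))
  have hy8 : ∀ n, ‖y n‖ ≤ 1 / 8 := fun n => by
    have hAx : A (x n) = 0 := (x n).2
    have : A' (x n) = -((A - A') (x n)) := by simp [hAx]
    calc ‖y n‖ ≤ C * ‖A' (x n)‖ := hyC n
      _ ≤ C * (‖A - A'‖ * 2) := by
        rw [this, norm_neg]
        gcongr
        exact (A - A').le_opNorm_of_le (hx n)
      _ ≤ 1 / 8 := by linarith
  let z : ℕ → LinearMap.ker (A' : E →ₗ[ℂ] G) := fun n => ⟨x n - y n, by simp [hy n]⟩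
  obtain ⟨m, n, hmn, hlt⟩ := exists_ne_norm_sub_lt z (R := 3) (ε := 1 / 4)
    (fun n => by
      have h₁ : ‖(x n : E)‖ ≤ 2 := hx n
      change ‖(x n : E) - y n‖ ≤ 3
      linarith [norm_sub_le (x n : E) (y n), hy8 n]) (by norm_num)
  have hone : 1 ≤ ‖(x m : E) - x n‖ := hx' hmn
  have hz : ‖((x m : E) - y m) - (x n - y n)‖ < 1 / 4 := hlt
  have : (x m : E) - x n = ((x m : E) - y m) - (x n - y n) + (y m - y n) := by abel
  rw [this] at hone
  linarith [norm_add_le (((x m : E) - y m) - (x n - y n)) (y m - y n), norm_sub_le (y m) (y n),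
    hy8 m, hy8 n]

theorem norm_le_two_mul_of_norm_sub_le {A A' : E →L[ℂ] G} {C : ℝ} (hC₀ : 0 ≤ C)
    (hC : ∀ u, ‖u‖ ≤ C * ‖A u‖) (hAA' : C * ‖A' - A‖ ≤ 1 / 2) (u : E) :
    ‖u‖ ≤ 2 * C * ‖A' u‖ := by
  have h₁ : A u = A' u - (A' - A) u := by simp
  have h₂ : C * ‖(A' - A) u‖ ≤ 1 / 2 * ‖u‖ := by
    calc C * ‖(A' - A) u‖ ≤ C * (‖A' - A‖ * ‖u‖) := by
          gcongr
          exact (A' - A).le_opNorm u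
      _ = C * ‖A' - A‖ * ‖u‖ := by ring
      _ ≤ 1 / 2 * ‖u‖ := by gcongr
  have h₃ : C * ‖A u‖ ≤ C * (‖A' u‖ + ‖(A' - A) u‖) := by
    rw [h₁]
    gcongr
    exact norm_sub_le _ _
  linarith [hC u]

/-- `A'` is approximated by `A` with error `‖A' - A‖`, so it maps the ball of radius `r` onto one of
radius at least `(C⁻¹ - ‖A' - A‖) r`; `r = 2 C ‖y‖` reaches `y`. -/
theorem exists_preimage_norm_le_of_norm_sub_le [CompleteSpace E] {A A' : E →L[ℂ] G} {C : ℝ}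
    (hC₀ : 0 < C) (hC : ∀ y, ∃ x, A x = y ∧ ‖x‖ ≤ C * ‖y‖) (hAA' : C * ‖A' - A‖ ≤ 1 / 2) (y : G) :
    ∃ x, A' x = y ∧ ‖x‖ ≤ 2 * C * ‖y‖ := by
  choose s hs hsC using hC
  let s' : A.NonlinearRightInverse := ⟨s, ⟨C, hC₀.le⟩, hsC, hs⟩
  have happ : ApproximatesLinearOn A' A Set.univ ‖A' - A‖₊ := fun u _ v _ => by
    simpa [sub_sub_sub_comm] using (A' - A).le_opNorm (u - v)
  obtain ⟨x, hx, hxy⟩ := happ.surjOn_closedBall_of_nonlinearRightInverse s' (b := 0)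
    (ε := 2 * C * ‖y‖) (by positivity) (Set.subset_univ _) (a := y) (by
      rw [map_zero, mem_closedBall_zero_iff]
      change ‖y‖ ≤ (C⁻¹ - ‖A' - A‖) * (2 * C * ‖y‖)
      have : (C⁻¹ - ‖A' - A‖) * (2 * C * ‖y‖) = 2 * (1 - C * ‖A' - A‖) * ‖y‖ := by
        field_simp
      rw [this]
      nlinarith [norm_nonneg y])
  exact ⟨x, hxy, mem_closedBall_zero_iff.1 hx⟩

end Perturbation

/-! ### Stability of the index under small perturbations -/

section Stability

variable {X : Type*} [NormedAddCommGroup X] [NormedSpace ℂ X]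

/-- The nullity may be infinite too, since `⊤ - ⊤ = ⊥` in `EReal`. -/
theorem semiFredholmIndex_eq_bot {S : X →L[ℂ] X} (h : deficiency S = ⊤) :
    semiFredholmIndex S = ⊥ := by
  simp [semiFredholmIndex, h]

theorem semiFredholmIndex_eq_top {S : X →L[ℂ] X} (h₁ : nullity S = ⊤) (h₂ : deficiency S < ⊤) :
    semiFredholmIndex S = ⊤ := by
  obtain ⟨n, hn⟩ := ENat.ne_top_iff_exists.1 h₂.ne
  rw [semiFredholmIndex, h₁, ← hn, coe_enat_natCast]
  exact EReal.top_sub_coe n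

theorem kerDim_subtype (p : Submodule ℂ X) : kerDim p.subtype = 0 :=
  kerDim_eq_zero p.injective_subtype

theorem cokerDim_subtype {p q : Submodule ℂ X} (h : IsCompl p q) :
    cokerDim p.subtype = edim q := by
  rw [cokerDim, Submodule.range_subtype]
  exact edim_congr (Submodule.quotientEquivOfIsCompl p q h)

theorem cokerDim_inl_lt_top (U V : Type*) [AddCommGroup U] [Module ℂ U] [AddCommGroup V]
    [Module ℂ V] [h : FiniteDimensional ℂ V] : cokerDim (LinearMap.inl ℂ U V) < ⊤ := by
  refine lt_of_le_of_lt ?_ (edim_lt_top_iff.2 h)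
  rw [cokerDim, LinearMap.range_inl]
  exact edim_le_of_injective ((LinearMap.ker (LinearMap.snd ℂ U V)).liftQ (LinearMap.snd ℂ U V)
    le_rfl) (LinearMap.ker_eq_bot.1 (Submodule.ker_liftQ_eq_bot _ _ _ le_rfl))

theorem exists_isClosed_isCompl_ker {S : X →L[ℂ] X} (h : nullity S < ⊤) :
    ∃ p : Submodule ℂ X, IsClosed (p : Set X) ∧
      IsCompl (LinearMap.ker (S : X →ₗ[ℂ] X)) p := by
  have : FiniteDimensional ℂ (LinearMap.ker (S : X →ₗ[ℂ] X)) := edim_lt_top_iff.1 h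
  exact (Submodule.ClosedComplemented.of_finiteDimensional _).exists_isClosed_isCompl

theorem exists_isCompl_range {S : X →L[ℂ] X} (h : deficiency S < ⊤) :
    ∃ p : Submodule ℂ X, FiniteDimensional ℂ p ∧
      IsCompl (LinearMap.range (S : X →ₗ[ℂ] X)) p := by
  obtain ⟨p, hp⟩ := Submodule.exists_isCompl (LinearMap.range (S : X →ₗ[ℂ] X))
  have : FiniteDimensional ℂ (X ⧸ LinearMap.range (S : X →ₗ[ℂ] X)) := edim_lt_top_iff.1 h
  exact ⟨p, (Submodule.quotientEquivOfIsCompl _ p hp).finiteDimensional, hp⟩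

theorem map_eq_map_of_isCompl_ker {S : X →ₗ[ℂ] X} {p : Submodule ℂ X}
    (hp : IsCompl (LinearMap.ker S) p) (x : X) : ∃ y : p, S y = S x := by
  obtain ⟨a, ha, b, hb, rfl⟩ := Submodule.mem_sup.1 (hp.sup_eq_top ▸ Submodule.mem_top (x := x))
  exact ⟨⟨b, hb⟩, by simp [LinearMap.mem_ker.1 ha]⟩

theorem injective_comp_subtype_of_isCompl_ker {S : X →ₗ[ℂ] X} {p : Submodule ℂ X}
    (hp : IsCompl (LinearMap.ker S) p) : Function.Injective (S ∘ₗ p.subtype) := by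
  rw [injective_iff_map_eq_zero]
  rintro ⟨x, hx⟩ h
  exact Subtype.ext (Submodule.disjoint_def.1 hp.disjoint x h hx)

theorem range_comp_subtype_of_isCompl_ker {S : X →ₗ[ℂ] X} {p : Submodule ℂ X}
    (hp : IsCompl (LinearMap.ker S) p) :
    LinearMap.range (S ∘ₗ p.subtype) = LinearMap.range S := by
  refine le_antisymm (LinearMap.range_comp_le_range _ _) ?_
  rintro _ ⟨x, rfl⟩
  obtain ⟨y, hy⟩ := map_eq_map_of_isCompl_ker hp x
  exact ⟨y, hy⟩

theorem eventually_mul_norm_comp_le {E G H : Type*} [NormedAddCommGroup E] [NormedSpace ℂ E]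
    [NormedAddCommGroup G] [NormedSpace ℂ G] [NormedAddCommGroup H] [NormedSpace ℂ H]
    (C : ℝ) (L : E →L[ℂ] G) {ε : ℝ} (hε : 0 < ε) :
    ∀ᶠ R : G →L[ℂ] H in 𝓝 0, C * ‖R ∘L L‖ ≤ ε := by
  have hc : Continuous fun R : G →L[ℂ] H => C * ‖R ∘L L‖ :=
    continuous_const.mul (continuous_id.clm_comp continuous_const).norm
  have := hc.tendsto 0
  rw [ContinuousLinearMap.zero_comp, norm_zero, mul_zero] at this
  exact this.eventually_le_const hε

variable [CompleteSpace X]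

/-- The index of a Fredholm operator is locally constant. -/
theorem eventually_semiFredholmIndex_eq_of_fredholm {S : X →L[ℂ] X} (h₁ : nullity S < ⊤)
    (h₂ : deficiency S < ⊤) :
    ∀ᶠ R : X →L[ℂ] X in 𝓝 0, semiFredholmIndex (S + R) = semiFredholmIndex S := by
  obtain ⟨p, hpc, hp⟩ := exists_isClosed_isCompl_ker h₁
  obtain ⟨q, hqf, hq⟩ := exists_isCompl_range h₂
  have := hpc.completeSpace_coe
  have := FiniteDimensional.complete ℂ q
  -- Dropping the kernel and adding a complement of the range makes `S` invertible, and
  -- invertibility is an open condition.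
  let Φ : (X →L[ℂ] X) → (p × q →L[ℂ] X) := fun R => ((S + R) ∘L p.subtypeL).coprod q.subtypeL
  have hΦ : Continuous Φ := by
    have : Φ = fun R => (S ∘L p.subtypeL).coprod q.subtypeL +
        R ∘L (p.subtypeL ∘L ContinuousLinearMap.fst ℂ p q) := by
      ext R x <;> simp [Φ]
    rw [this]
    exact continuous_const.add (continuous_id.clm_comp continuous_const)
  have hinj : Function.Injective (Φ 0) := by
    rw [injective_iff_map_eq_zero]
    rintro ⟨x, y⟩ hxy
    have hxy : S x + y = 0 := by simpa [Φ] using hxy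
    have hy : (y : X) = 0 := Submodule.disjoint_def.1 hq.disjoint y
      ⟨-x, by simpa using neg_eq_of_add_eq_zero_right hxy⟩ y.2
    rw [hy, add_zero] at hxy
    exact Prod.ext (injective_comp_subtype_of_isCompl_ker hp (by simpa using hxy)) (Subtype.ext hy)
  have hsurj : Function.Surjective (Φ 0) := by
    intro z
    obtain ⟨_, ⟨a, rfl⟩, b, hb, rfl⟩ :=
      Submodule.mem_sup.1 (hq.sup_eq_top ▸ Submodule.mem_top (x := z))
    obtain ⟨x, hx⟩ := map_eq_map_of_isCompl_ker hp a
    exact ⟨(x, ⟨b, hb⟩), by simpa [Φ] using hx⟩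
  let e : (p × q) ≃L[ℂ] X := ContinuousLinearEquiv.ofBijective (Φ 0)
    (LinearMap.ker_eq_bot.2 hinj) (LinearMap.range_eq_top.2 hsurj)
  have hev : ∀ᶠ R in 𝓝 0, Function.Bijective (Φ R) := by
    have : Set.range ((↑) : ((p × q) ≃L[ℂ] X) → (p × q →L[ℂ] X)) ∈ 𝓝 (Φ 0) :=
      ContinuousLinearEquiv.nhds e
    filter_upwards [hΦ.continuousAt this] with R hR
    obtain ⟨e', he'⟩ := hR
    rw [← he']
    exact e'.bijective
  -- The restriction of `S + R` to `p` factors through `p.subtype` and through `Φ R`. Comparing the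
  -- two expresses the index by dimensions independent of `R`.
  have key : ∀ R, Function.Bijective (Φ R) →
      nullity (S + R) + cokerDim (LinearMap.inl ℂ p q) = cokerDim p.subtype + deficiency (S + R)
        ∧ deficiency (S + R) ≤ cokerDim (LinearMap.inl ℂ p q) := by
    intro R hR
    set A : p →ₗ[ℂ] X := ((S + R : X →L[ℂ] X) : X →ₗ[ℂ] X) ∘ₗ p.subtype with hA
    have hA' : A = (Φ R : (p × q) →ₗ[ℂ] X) ∘ₗ LinearMap.inl ℂ p q := by
      ext x
      simp [A, Φ]
    have hAinj : kerDim A = 0 := by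
      rw [hA']
      exact kerDim_eq_zero (hR.1.comp LinearMap.inl_injective)
    have hAcoker : cokerDim A = cokerDim (LinearMap.inl ℂ p q) := by
      have := kerDim_add_kerDim_add_cokerDim_comp (LinearMap.inl ℂ p q)
        (Φ R : (p × q) →ₗ[ℂ] X)
      rw [← hA', hAinj, kerDim_eq_zero LinearMap.inl_injective, kerDim_eq_zero hR.1,
        cokerDim_eq_zero hR.2] at this
      simpa using this
    have := kerDim_add_kerDim_add_cokerDim_comp p.subtype ((S + R : X →L[ℂ] X) : X →ₗ[ℂ] X)
    rw [← hA, hAinj, hAcoker, kerDim_subtype, zero_add, zero_add] at this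
    exact ⟨this, hAcoker ▸ cokerDim_le_cokerDim_comp p.subtype _⟩
  have hq' : cokerDim (LinearMap.inl ℂ p q) < ⊤ := cokerDim_inl_lt_top p q
  have hp' : cokerDim p.subtype < ⊤ := by
    rw [cokerDim_subtype hp.symm]
    exact h₁
  have hindex : ∀ R, Function.Bijective (Φ R) → semiFredholmIndex (S + R) =
      ((cokerDim p.subtype : ENNReal) : EReal) -
        ((cokerDim (LinearMap.inl ℂ p q) : ENNReal) : EReal) := fun R hR =>
    eReal_sub_eq_of_add_eq_add ((key R hR).2.trans_lt hq') hp' hq' (key R hR).1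
  filter_upwards [hev] with R hR
  rw [hindex R hR, ← hindex 0 ⟨hinj, hsurj⟩, add_zero]

/-- Index `-∞` is stable under small perturbations. -/
theorem eventually_semiFredholmIndex_eq_of_upper {S : X →L[ℂ] X} (hS : IsClosed (Set.range S))
    (h₁ : nullity S < ⊤) (h₂ : deficiency S = ⊤) :
    ∀ᶠ R : X →L[ℂ] X in 𝓝 0, semiFredholmIndex (S + R) = semiFredholmIndex S := by
  obtain ⟨p, hpc, hp⟩ := exists_isClosed_isCompl_ker h₁
  have := hpc.completeSpace_coe
  let A : p →L[ℂ] X := S ∘L p.subtypeL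
  have hArange : LinearMap.range (A : p →ₗ[ℂ] X) = LinearMap.range (S : X →ₗ[ℂ] X) :=
    range_comp_subtype_of_isCompl_ker hp
  have hAcl : IsClosed (Set.range A) := by
    have : Set.range A = Set.range S := congrArg (fun s : Submodule ℂ X => (s : Set X)) hArange
    rwa [this]
  obtain ⟨K, hK⟩ := A.antilipschitz_of_injective_of_isClosed_range
    (injective_comp_subtype_of_isCompl_ker hp) hAcl
  have hC : ∀ u, ‖u‖ ≤ K * ‖A u‖ := fun u => by simpa using hK.le_mul_dist u 0
  filter_upwards [eventually_mul_norm_comp_le (H := X) (2 * K) p.subtypeL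
    (show (0 : ℝ) < 1 / 16 by norm_num)] with R hR
  rw [semiFredholmIndex_eq_bot h₂]
  -- If `S + R` had finite deficiency, so would its restriction `A'` to `p`; perturbing back from
  -- `A'` to `A` would make the deficiency of `S` finite.
  refine semiFredholmIndex_eq_bot (not_lt_top_iff.1 fun hlt => ?_)
  let A' : p →L[ℂ] X := (S + R) ∘L p.subtypeL
  have hsub : A' - A = R ∘L p.subtypeL := by
    ext
    simp [A, A']
  have hC' := norm_le_two_mul_of_norm_sub_le (A' := A') K.coe_nonneg hC
    (by rw [hsub]; linarith)
  have hA'cok : cokerDim (A' : p →ₗ[ℂ] X) < ⊤ := by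
    refine (cokerDim_comp_le p.subtype ((S + R : X →L[ℂ] X) : X →ₗ[ℂ] X)).trans_lt
      (WithTop.add_lt_top.2 ⟨?_, hlt⟩)
    rw [cokerDim_subtype hp.symm]
    exact h₁
  have hAcok : cokerDim (A : p →ₗ[ℂ] X) < ⊤ := cokerDim_lt_top_of_norm_sub_le (by positivity) hC'
    hAcl (by rwa [norm_sub_rev, hsub]) hA'cok
  rw [cokerDim, hArange] at hAcok
  exact hAcok.ne h₂

/-- Index `+∞` is stable under small perturbations. -/
theorem eventually_semiFredholmIndex_eq_of_lower {S : X →L[ℂ] X} (h₁ : nullity S = ⊤)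
    (h₂ : deficiency S < ⊤) :
    ∀ᶠ R : X →L[ℂ] X in 𝓝 0, semiFredholmIndex (S + R) = semiFredholmIndex S := by
  obtain ⟨q, hqf, hq⟩ := exists_isCompl_range h₂
  have := FiniteDimensional.complete ℂ q
  -- Adjoining the finite-dimensional `q` makes `S` surjective and does not affect whether the
  -- kernel is finite-dimensional.
  let Φ : (X →L[ℂ] X) → (X × q →L[ℂ] X) := fun R => (S + R).coprod q.subtypeL
  have hsurj : Function.Surjective (Φ 0) := by
    intro z
    obtain ⟨_, ⟨a, rfl⟩, b, hb, rfl⟩ :=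
      Submodule.mem_sup.1 (hq.sup_eq_top ▸ Submodule.mem_top (x := z))
    exact ⟨(a, ⟨b, hb⟩), by simp [Φ]⟩
  obtain ⟨C, hC₀, hC⟩ := (Φ 0).exists_preimage_norm_le hsurj
  have hinl : cokerDim (LinearMap.inl ℂ X q) < ⊤ := cokerDim_inl_lt_top X q
  have hcomp : ∀ R, ((S + R : X →L[ℂ] X) : X →ₗ[ℂ] X) =
      (Φ R : X × q →ₗ[ℂ] X) ∘ₗ LinearMap.inl ℂ X q := fun R => by
    ext
    simp [Φ]
  have hnull : ∀ R, nullity (S + R) ≤ kerDim (Φ R : X × q →ₗ[ℂ] X) := fun R => by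
    have := kerDim_comp_le (LinearMap.inl ℂ X q) (Φ R : X × q →ₗ[ℂ] X)
    rwa [← hcomp, kerDim_eq_zero (f := LinearMap.inl ℂ X q) LinearMap.inl_injective,
      zero_add] at this
  rw [semiFredholmIndex_eq_top h₁ h₂]
  filter_upwards [eventually_mul_norm_comp_le (H := X) (2 * C) (ContinuousLinearMap.fst ℂ X q)
    (show (0 : ℝ) < 1 / 16 by norm_num)] with R hR
  have hsub : Φ R - Φ 0 = R ∘L ContinuousLinearMap.fst ℂ X q := by
    ext <;> simp [Φ]
  have hC' := exists_preimage_norm_le_of_norm_sub_le (A' := Φ R) hC₀ hC (by rw [hsub]; linarith)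
  have hdef : deficiency (S + R) < ⊤ := by
    refine lt_of_le_of_lt ?_ hinl
    have := cokerDim_comp_le (LinearMap.inl ℂ X q) (Φ R : X × q →ₗ[ℂ] X)
    rwa [← hcomp, cokerDim_eq_zero fun y => (hC' y).imp fun _ h => h.1, add_zero] at this
  refine semiFredholmIndex_eq_top (not_lt_top_iff.1 fun hlt => ?_) hdef
  have hker : kerDim (Φ R : X × q →ₗ[ℂ] X) < ⊤ := by
    refine (kerDim_le_kerDim_comp_add (LinearMap.inl ℂ X q) _).trans_lt
      (WithTop.add_lt_top.2 ⟨?_, hinl⟩)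
    rwa [← hcomp]
  have hlt' := (hnull 0).trans_lt (kerDim_lt_top_of_norm_sub_le (A := Φ 0) (by positivity) hC'
    (by rwa [norm_sub_rev, hsub]) hker)
  rw [add_zero] at hlt'
  exact hlt'.ne h₁

theorem eventually_semiFredholmIndex_eq {S : X →L[ℂ] X} (hS : IsSemiFredholm S) :
    ∀ᶠ R : X →L[ℂ] X in 𝓝 0, semiFredholmIndex (S + R) = semiFredholmIndex S := by
  rcases eq_top_or_lt_top (deficiency S) with hd | hd
  · rcases hS with hS | hS
    · exact eventually_semiFredholmIndex_eq_of_upper hS.1 hS.2 hd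
    · exact absurd hd hS.ne
  · rcases eq_top_or_lt_top (nullity S) with hn | hn
    · exact eventually_semiFredholmIndex_eq_of_lower hn hd
    · exact eventually_semiFredholmIndex_eq_of_fredholm hn hd

end Stability

/-! ### Reducing pairs and independence of the index -/

section Decomposition

variable {X : Type*} [NormedAddCommGroup X] [NormedSpace ℂ X] {T : X →L[ℂ] X}

theorem nullity_eq_of_bijective_restrictN (P : Red T) (hN : Function.Bijective P.restrictN) :
    nullity T = nullity P.restrictM := by
  let f : LinearMap.ker (P.restrictM : P.M →ₗ[ℂ] P.M) →ₗ[ℂ] LinearMap.ker (T : X →ₗ[ℂ] X) :=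
    P.M.subtype.restrict fun x hx => congrArg Subtype.val hx
  have hinj : Function.Injective f := fun x y h =>
    Subtype.ext (Subtype.ext (congrArg
      (fun z : LinearMap.ker (T : X →ₗ[ℂ] X) => (z : X)) h))
  have hsurj : Function.Surjective f := by
    rintro ⟨x, hx⟩
    obtain ⟨m, hm, n, hn, rfl⟩ :=
      Submodule.mem_sup.1 (P.isCompl.sup_eq_top ▸ Submodule.mem_top (x := x))
    have hsum : T m + T n = 0 := by
      rw [← map_add]
      exact hx
    have hTn : T n = 0 := Submodule.disjoint_def.1 P.isCompl.disjoint _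
      (by rw [eq_neg_of_add_eq_zero_right hsum]; exact neg_mem (P.invariant_M m hm))
      (P.invariant_N n hn)
    have hn0 : (⟨n, hn⟩ : P.N) = 0 := hN.1 (Subtype.ext (hTn.trans (map_zero T).symm))
    have hn0 : n = 0 := congrArg Subtype.val hn0
    subst hn0
    refine ⟨⟨⟨m, hm⟩, Subtype.ext ?_⟩, Subtype.ext (add_zero m).symm⟩
    change T m = 0
    simpa using hsum
  exact (edim_congr (LinearEquiv.ofBijective f ⟨hinj, hsurj⟩)).symm

theorem deficiency_eq_of_bijective_restrictN (P : Red T) (hN : Function.Bijective P.restrictN) :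
    deficiency T = deficiency P.restrictM := by
  let f : (P.M ⧸ LinearMap.range (P.restrictM : P.M →ₗ[ℂ] P.M)) →ₗ[ℂ]
      X ⧸ LinearMap.range (T : X →ₗ[ℂ] X) :=
    Submodule.mapQ _ _ P.M.subtype (by rintro _ ⟨x, rfl⟩; exact ⟨x, rfl⟩)
  have hinj : Function.Injective f := by
    rw [injective_iff_map_eq_zero]
    intro y hy
    obtain ⟨y, rfl⟩ := Submodule.Quotient.mk_surjective _ y
    rw [Submodule.mapQ_apply, Submodule.Quotient.mk_eq_zero] at hy
    obtain ⟨x, hx⟩ := hy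
    obtain ⟨m, hm, n, hn, rfl⟩ :=
      Submodule.mem_sup.1 (P.isCompl.sup_eq_top ▸ Submodule.mem_top (x := x))
    have hx : T m + T n = y := by
      rw [← map_add]
      exact hx
    have hTn : T n = 0 := Submodule.disjoint_def.1 P.isCompl.disjoint _
      (by rw [eq_sub_of_add_eq' hx]; exact sub_mem y.2 (P.invariant_M m hm))
      (P.invariant_N n hn)
    rw [Submodule.Quotient.mk_eq_zero]
    exact ⟨⟨m, hm⟩, Subtype.ext (by rwa [hTn, add_zero] at hx)⟩
  have hsurj : Function.Surjective f := by
    intro y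
    obtain ⟨y, rfl⟩ := Submodule.Quotient.mk_surjective _ y
    obtain ⟨m, hm, n, hn, rfl⟩ :=
      Submodule.mem_sup.1 (P.isCompl.sup_eq_top ▸ Submodule.mem_top (x := y))
    refine ⟨Submodule.Quotient.mk ⟨m, hm⟩, ?_⟩
    obtain ⟨n', hn'⟩ := hN.2 ⟨n, hn⟩
    rw [Submodule.mapQ_apply, Submodule.Quotient.eq]
    have hn' : T n' = n := congrArg Subtype.val hn'
    exact ⟨-n', by simp [hn']⟩
  exact (edim_congr (LinearEquiv.ofBijective f ⟨hinj, hsurj⟩)).symm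

theorem semiFredholmIndex_eq_of_bijective_restrictN (P : Red T)
    (hN : Function.Bijective P.restrictN) :
    semiFredholmIndex T = semiFredholmIndex P.restrictM := by
  rw [semiFredholmIndex, semiFredholmIndex, nullity_eq_of_bijective_restrictN P hN,
    deficiency_eq_of_bijective_restrictN P hN]

/-- A pair reducing `T` reduces `T + c`. -/
def Red.addSMulOne (P : Red T) (c : ℂ) : Red (T + c • (1 : X →L[ℂ] X)) where
  M := P.M
  N := P.N
  isClosed_M := P.isClosed_M
  isClosed_N := P.isClosed_N
  invariant_M x hx := P.M.add_mem (P.invariant_M x hx) (P.M.smul_mem c hx)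
  invariant_N x hx := P.N.add_mem (P.invariant_N x hx) (P.N.smul_mem c hx)
  isCompl := P.isCompl

/-- A pair reducing `T` reduces its powers. -/
def Red.pow (P : Red T) (n : ℕ) : Red (T ^ n) where
  M := P.M
  N := P.N
  isClosed_M := P.isClosed_M
  isClosed_N := P.isClosed_N
  invariant_M x hx := by
    induction n with
    | zero => exact hx
    | succ n ih =>
      rw [pow_succ']
      exact P.invariant_M _ ih
  invariant_N x hx := by
    induction n with
    | zero => exact hx
    | succ n ih =>
      rw [pow_succ']
      exact P.invariant_N _ ih
  isCompl := P.isCompl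

theorem coe_restrict_pow {p : Submodule ℂ X} (h : ∀ x ∈ p, T x ∈ p) (n : ℕ) (x : p) :
    (((T.restrict h) ^ n) x : X) = (T ^ n) x := by
  induction n with
  | zero => rfl
  | succ n ih =>
    rw [pow_succ', pow_succ', mul_apply_eq_comp, mul_apply_eq_comp, ← ih]
    rfl

theorem Red.restrictM_pow (P : Red T) (n : ℕ) : (P.pow n).restrictM = P.restrictM ^ n := by
  ext x
  exact (coe_restrict_pow P.invariant_M n x).symm

theorem Red.restrictN_pow (P : Red T) (n : ℕ) : (P.pow n).restrictN = P.restrictN ^ n := by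
  ext x
  exact (coe_restrict_pow P.invariant_N n x).symm

theorem IsQuasinilpotent.bijective_add_smul_one [CompleteSpace X] (hT : IsQuasinilpotent T)
    {c : ℂ} (hc : c ≠ 0) :
    Function.Bijective (T + c • (1 : X →L[ℂ] X)) := by
  have h : -c ∉ spectrum ℂ T := fun h => hc (by simpa using hT h)
  rw [spectrum.notMem_iff, ← IsUnit.neg_iff] at h
  convert ContinuousLinearMap.isUnit_iff_bijective.1 h using 2
  rw [Algebra.algebraMap_eq_smul_one]
  simp

/-- Spectral mapping for a positive exponent also covers the zero space, where the spectrum is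
empty. -/
theorem IsQuasinilpotent.pow (hT : IsQuasinilpotent T) {n : ℕ} (hn : 1 ≤ n) :
    IsQuasinilpotent (T ^ n) := by
  rw [IsQuasinilpotent, spectrum.map_pow_of_pos T hn]
  rintro _ ⟨c, hc, rfl⟩
  have : c = 0 := hT hc
  simp [this, Nat.one_le_iff_ne_zero.1 hn]

variable [CompleteSpace X]

theorem Red.eventually_semiFredholmIndex_eq (P : Red T) (hM : IsSemiFredholm P.restrictM)
    (hN : IsQuasinilpotent P.restrictN) :
    ∀ᶠ c : ℂ in 𝓝[≠] 0,
      semiFredholmIndex (T + c • (1 : X →L[ℂ] X)) = semiFredholmIndex P.restrictM := by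
  have := P.isClosed_M.completeSpace_coe
  have := P.isClosed_N.completeSpace_coe
  have hlim : Tendsto (fun c : ℂ => c • (1 : P.M →L[ℂ] P.M)) (𝓝[≠] 0) (𝓝 0) := by
    have : Continuous fun c : ℂ => c • (1 : P.M →L[ℂ] P.M) := by fun_prop
    exact tendsto_nhdsWithin_of_tendsto_nhds (this.tendsto' 0 0 (by ext x; simp))
  filter_upwards [hlim.eventually (PseudoFredholm.eventually_semiFredholmIndex_eq hM),
    self_mem_nhdsWithin] with c hc hc₀
  rw [← hc, semiFredholmIndex_eq_of_bijective_restrictN (P.addSMulOne c)]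
  · rfl
  · exact hN.bijective_add_smul_one hc₀

theorem Red.semiFredholmIndex_eq (P Q : Red T) (hPM : IsSemiFredholm P.restrictM)
    (hPN : IsQuasinilpotent P.restrictN) (hQM : IsSemiFredholm Q.restrictM)
    (hQN : IsQuasinilpotent Q.restrictN) :
    semiFredholmIndex P.restrictM = semiFredholmIndex Q.restrictM := by
  -- One small `c ≠ 0` serves both pairs; both indices equal that of `T + c`.
  obtain ⟨c, hP, hQ⟩ := ((P.eventually_semiFredholmIndex_eq hPM hPN).and
    (Q.eventually_semiFredholmIndex_eq hQM hQN)).exists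
  exact hP.symm.trans hQ

theorem Red.semiFredholmIndex_eq_pseudoIndex (P : Red T) (hM : IsSemiFredholm P.restrictM)
    (hN : IsQuasinilpotent P.restrictN) : semiFredholmIndex P.restrictM = pseudoIndex T := by
  have h : IsPseudoSemiBFredholm T := (isPseudoSemiBFredholm_iff T).2 ⟨P, hM, hN⟩
  rw [pseudoIndex, dif_pos h]
  have hQ := ((isPseudoSemiBFredholm_iff T).1 h).choose_spec
  exact P.semiFredholmIndex_eq _ hM hN hQ.1 hQ.2

end Decomposition

/-! ### Index and closed range of powers -/

section Powers

variable {X : Type*} [NormedAddCommGroup X] [NormedSpace ℂ X] {S : X →L[ℂ] X}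

theorem toLinearMap_pow_succ (S : X →L[ℂ] X) (n : ℕ) :
    ((S ^ (n + 1) : X →L[ℂ] X) : X →ₗ[ℂ] X) = (S : X →ₗ[ℂ] X) ∘ₗ ((S ^ n : X →L[ℂ] X)) := by
  rw [pow_succ']
  rfl

theorem toLinearMap_pow_succ' (S : X →L[ℂ] X) (n : ℕ) :
    ((S ^ (n + 1) : X →L[ℂ] X) : X →ₗ[ℂ] X) = ((S ^ n : X →L[ℂ] X) : X →ₗ[ℂ] X) ∘ₗ S := by
  rw [pow_succ]
  rfl

theorem nullity_one : nullity (1 : X →L[ℂ] X) = 0 :=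
  kerDim_eq_zero (f := ((1 : X →L[ℂ] X) : X →ₗ[ℂ] X)) fun _ _ h => h

theorem deficiency_one : deficiency (1 : X →L[ℂ] X) = 0 :=
  cokerDim_eq_zero (f := ((1 : X →L[ℂ] X) : X →ₗ[ℂ] X)) fun x => ⟨x, rfl⟩

theorem nullity_pow_lt_top (h : nullity S < ⊤) (n : ℕ) : nullity (S ^ n) < ⊤ := by
  induction n with
  | zero =>
    simp [nullity_one]
  | succ n ih =>
    have := kerDim_comp_le ((S ^ n : X →L[ℂ] X) : X →ₗ[ℂ] X) (S : X →ₗ[ℂ] X)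
    rw [← toLinearMap_pow_succ] at this
    exact this.trans_lt (WithTop.add_lt_top.2 ⟨ih, h⟩)

theorem deficiency_pow_lt_top (h : deficiency S < ⊤) (n : ℕ) : deficiency (S ^ n) < ⊤ := by
  induction n with
  | zero =>
    simp [deficiency_one]
  | succ n ih =>
    have := cokerDim_comp_le ((S ^ n : X →L[ℂ] X) : X →ₗ[ℂ] X) (S : X →ₗ[ℂ] X)
    rw [← toLinearMap_pow_succ] at this
    exact this.trans_lt (WithTop.add_lt_top.2 ⟨ih, h⟩)

theorem nullity_le_nullity_pow {n : ℕ} (hn : 1 ≤ n) : nullity S ≤ nullity (S ^ n) := by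
  obtain ⟨n, rfl⟩ := Nat.exists_eq_add_of_le' hn
  have := kerDim_le_kerDim_comp (S : X →ₗ[ℂ] X) ((S ^ n : X →L[ℂ] X) : X →ₗ[ℂ] X)
  rwa [← toLinearMap_pow_succ'] at this

theorem deficiency_le_deficiency_pow {n : ℕ} (hn : 1 ≤ n) :
    deficiency S ≤ deficiency (S ^ n) := by
  obtain ⟨n, rfl⟩ := Nat.exists_eq_add_of_le' hn
  have := cokerDim_le_cokerDim_comp ((S ^ n : X →L[ℂ] X) : X →ₗ[ℂ] X) (S : X →ₗ[ℂ] X)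
  rwa [← toLinearMap_pow_succ] at this

/-- Additivity of the index, iterated without subtraction; finite deficiency of `S ^ n` permits the
cancellation. -/
theorem nullity_pow_add (h₂ : deficiency S < ⊤) (n : ℕ) :
    nullity (S ^ n) + n * deficiency S = n * nullity S + deficiency (S ^ n) := by
  induction n with
  | zero =>
    simp [nullity_one, deficiency_one]
  | succ n ih =>
    have h := kerDim_add_kerDim_add_cokerDim_comp ((S ^ n : X →L[ℂ] X) : X →ₗ[ℂ] X)
      (S : X →ₗ[ℂ] X)
    rw [← toLinearMap_pow_succ] at h
    change nullity (S ^ n) + nullity S + deficiency (S ^ (n + 1)) =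
      nullity (S ^ (n + 1)) + deficiency (S ^ n) + deficiency S at h
    have hfin := deficiency_pow_lt_top h₂ n
    refine WithTop.add_left_cancel hfin.ne ?_
    calc deficiency (S ^ n) + (nullity (S ^ (n + 1)) + (n + 1 : ℕ) * deficiency S)
        = (nullity (S ^ (n + 1)) + deficiency (S ^ n) + deficiency S) + n * deficiency S := by
          push_cast; ring
      _ = (nullity (S ^ n) + n * deficiency S) + nullity S + deficiency (S ^ (n + 1)) := by
          rw [← h]; ring
      _ = deficiency (S ^ n) + ((n + 1 : ℕ) * nullity S + deficiency (S ^ (n + 1))) := by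
          rw [ih]; push_cast; ring

theorem semiFredholmIndex_pow (S : X →L[ℂ] X) {n : ℕ} (hn : 1 ≤ n) :
    semiFredholmIndex (S ^ n) = n * semiFredholmIndex S := by
  -- Positivity makes `n * ⊥ = ⊥` and `n * ⊤ = ⊤`.
  have hn' : (0 : EReal) < n := by exact_mod_cast hn
  rcases eq_top_or_lt_top (deficiency S) with hd | hd
  · rw [semiFredholmIndex_eq_bot hd, semiFredholmIndex_eq_bot
      (top_le_iff.1 (hd ▸ deficiency_le_deficiency_pow hn)), EReal.mul_bot_of_pos hn']
  · have hdn := deficiency_pow_lt_top hd n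
    rcases eq_top_or_lt_top (nullity S) with hk | hk
    · rw [semiFredholmIndex_eq_top hk hd, semiFredholmIndex_eq_top
        (top_le_iff.1 (hk ▸ nullity_le_nullity_pow hn)) hdn, EReal.mul_top_of_pos hn']
    · have h := nullity_pow_add hd n
      have hkn := nullity_pow_lt_top hk n
      rw [semiFredholmIndex, semiFredholmIndex]
      generalize nullity S = a at *
      generalize nullity (S ^ n) = b at *
      generalize deficiency S = c at *
      generalize deficiency (S ^ n) = d at *
      lift a to ℕ using hk.ne
      lift b to ℕ using hkn.ne
      lift c to ℕ using hd.ne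
      lift d to ℕ using hdn.ne
      have h' : (b : ℝ) + n * c = n * a + d := by exact_mod_cast h
      simp only [coe_enat_natCast, ← EReal.coe_sub, ← EReal.coe_coe_eq_natCast, ← EReal.coe_mul]
      congr 1
      linarith

variable [CompleteSpace X]

/-- Onto its closed range `S` is a quotient map, and the preimage of `S '' p` is `p ⊔ ker S`, closed
because the kernel is finite-dimensional. -/
theorem IsUpperSemiFredholm.isClosed_image (hS : IsUpperSemiFredholm S) {p : Submodule ℂ X}
    (hp : IsClosed (p : Set X)) : IsClosed (S '' p) := by
  have : FiniteDimensional ℂ (LinearMap.ker (S : X →ₗ[ℂ] X)) := edim_lt_top_iff.1 hS.2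
  let q : Submodule ℂ X := LinearMap.range (S : X →ₗ[ℂ] X)
  have hq : IsClosed (q : Set X) := hS.1
  have := hq.completeSpace_coe
  let S' : X →L[ℂ] q := S.codRestrict q fun x => ⟨x, rfl⟩
  have hS' : Function.Surjective S' := by
    rintro ⟨_, x, rfl⟩
    exact ⟨x, rfl⟩
  have hpre : S' ⁻¹' (S' '' p) = (p ⊔ LinearMap.ker (S : X →ₗ[ℂ] X) : Submodule ℂ X) := by
    ext x
    rw [SetLike.mem_coe, Submodule.mem_sup]
    constructor
    · rintro ⟨y, hy, hyx⟩
      have hyx : S y = S x := congrArg Subtype.val hyx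
      exact ⟨y, hy, x - y, by simp [hyx], by abel⟩
    · rintro ⟨y, hy, z, hz, rfl⟩
      have hz : S z = 0 := hz
      exact ⟨y, hy, Subtype.ext (by change S y = S (y + z); simp [hz])⟩
  have hcl : IsClosed (S' '' p) := by
    rw [← (S'.isQuotientMap hS').isClosed_preimage, hpre]
    exact Submodule.isClosed_sup_finiteDimensional _ _ hp
  have himg : S '' p = Subtype.val '' (S' '' p) := by
    rw [Set.image_image]
    rfl
  rw [himg]
  exact hq.isClosedEmbedding_subtypeVal.isClosedMap _ hcl

theorem IsUpperSemiFredholm.pow (hS : IsUpperSemiFredholm S) (n : ℕ) :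
    IsUpperSemiFredholm (S ^ n) := by
  refine ⟨?_, nullity_pow_lt_top hS.2 n⟩
  induction n with
  | zero =>
    have : Set.range (S ^ 0 : X →L[ℂ] X) = Set.univ := Set.range_eq_univ.2 fun x => ⟨x, rfl⟩
    rw [this]
    exact isClosed_univ
  | succ n ih =>
    have : Set.range (S ^ (n + 1) : X →L[ℂ] X) =
        S '' (LinearMap.range ((S ^ n : X →L[ℂ] X) : X →ₗ[ℂ] X) : Submodule ℂ X) := by
      rw [LinearMap.coe_range, pow_succ', ← Set.range_comp]
      rfl
    rw [this]
    exact hS.isClosed_image ih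

theorem IsSemiFredholm.pow (hS : IsSemiFredholm S) (n : ℕ) : IsSemiFredholm (S ^ n) :=
  hS.imp (fun h => h.pow n) (fun h => deficiency_pow_lt_top h n)

end Powers

end PseudoFredholm

/-- The index of a pseudo semi-B-Fredholm operator `T` does not depend on the decomposition used
to compute it, and every power `T ^ n` with `n ≥ 1` is pseudo semi-B-Fredholm of index
`n * ind T`, an identity in `ℤ ∪ {-∞, +∞}`. -/
theorem mainTheorem12 {X : Type*} [NormedAddCommGroup X] [NormedSpace ℂ X] [CompleteSpace X]
    (T : X →L[ℂ] X) (hT : PseudoFredholm.IsPseudoSemiBFredholm T) :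
    (∀ P : PseudoFredholm.Red T, PseudoFredholm.IsSemiFredholm P.restrictM →
      PseudoFredholm.IsQuasinilpotent P.restrictN →
        PseudoFredholm.semiFredholmIndex P.restrictM = PseudoFredholm.pseudoIndex T) ∧
    ∀ n : ℕ, 1 ≤ n →
      PseudoFredholm.IsPseudoSemiBFredholm (T ^ n) ∧
        PseudoFredholm.pseudoIndex (T ^ n) = (n : EReal) * PseudoFredholm.pseudoIndex T := by
  obtain ⟨P, hM, hN⟩ := (PseudoFredholm.isPseudoSemiBFredholm_iff T).1 hT
  refine ⟨fun Q hQM hQN => Q.semiFredholmIndex_eq_pseudoIndex hQM hQN, fun n hn => ?_⟩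
  have := P.isClosed_M.completeSpace_coe
  have hMn : PseudoFredholm.IsSemiFredholm (P.pow n).restrictM := P.restrictM_pow n ▸ hM.pow n
  have hNn : PseudoFredholm.IsQuasinilpotent (P.pow n).restrictN := P.restrictN_pow n ▸ hN.pow hn
  refine ⟨(PseudoFredholm.isPseudoSemiBFredholm_iff _).2 ⟨P.pow n, hMn, hNn⟩, ?_⟩
  rw [← (P.pow n).semiFredholmIndex_eq_pseudoIndex hMn hNn,
    ← P.semiFredholmIndex_eq_pseudoIndex hM hN, P.restrictM_pow]
  exact PseudoFredholm.semiFredholmIndex_pow P.restrictM hn
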